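/- Let $X$ be the graph with vertex set $\mathbb{Z}^2$ in which two points are joined by an edge iff their $\ell_1$-distance is $1$. For a finite $A\subset\mathbb{Z}^2$ let $\partial A$ be its vertex boundary, the set of points outside $A$ adjacent to a point of $A$. A nonempty finite set $A$ is *minimal* if $|\partial A|\le|\partial B|$ for every $B\subset\mathbb{Z}^2$ with $|B|=|A|$. Two sets are *congruent* if an automorphism of $X$ maps one onto the other. The *graph of minimal sets* $\mathcal{G}$ has as vertices the congruence classes of minimal sets; two classes are adjacent iff they have representatives $A,B$ with $|A\,\triangle\,B|=1$. The *height* of a connected component of $\mathcal{G}$ is the maximal length (number of terms) of a strictly nested sequence of minimal sets whose classes lie in it. A *box* is a nonempty set $B(a,b,c,d)=\{(x,y)\in\mathbb{Z}^2 : a\le y-x\le b,\ c\le y+x\le d\}$ with $a,b,c,d\in\mathbb{Z}$; its *modulus* is the unordered pair $\{b-a,d-c\}$, where among all parameters describing the box $a,c$ are chosen maximal and $b,d$ minimal. The *enclosing box* $\mathrm{enc}(A)$ of a nonempty finite set $A$ is the smallest box containing $A$. The *excess* of $A$ is $\mathrm{Exc}(A)=\max\{|A|-|B| : B \text{ minimal},\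 |\partial B|=|\partial A|\}$. A *standard line* is a set $\{(x,y)\in\mathbb{Z}^2 : y-x=w\}$ or $\{(x,y)\in\mathbb{Z}^2 : y+x=w\}$ with $w\in\mathbb{Z}$. The *life expectancy* of a minimal set $A$ is the maximal $n$ (possibly $\infty$) for which there are minimal sets $A=A_0\subset A_1\subset\dots\subset A_n$ with $|A_i|=|A|+i$; a minimal set is *dead* if its life expectancy is $0$. **Theorem.** (1) Let $B$ be a box such that $\mathrm{Exc}(B)=d\ge 0$; its modulus $\{\alpha,\beta\}$ satisfies $\alpha,\beta\ge 2$; every standard line $L$ has $B\cap L=\emptyset$ or $|B\cap L|\ge d+2$; and $B$ is dead. Let $\mathcal{C}$ be the component of $\mathcal{G}$ containing the class of $B$. Then every set $A$ representing a vertex of $\mathcal{C}$ satisfies $|B|-d\le|A|\le|B|$, and $\mathrm{enc}(A)$ is congruent to $B$; for every integer $k$ with $|B|-d\le k\le|B|$ some vertex of $\mathcal{C}$ is represented by a set of size $k$; and $\mathcal{C}$ is finite and has height exactly $d+1$. (2) $\mathcal{G}$ has finite components of arbitrarily large height: for every $n\in\mathbb{N}$ there is a finite component of $\mathcal{G}$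 whose height is finite and at least $n$. (3) $\mathcal{G}$ has infinitely many isolated vertices. -/

import Mathlib

open scoped symmDiff

/-! ### The lattice graph, vertex boundaries and minimal sets -/

/-- The graph on `ℤ²` joining points at `ℓ₁`-distance one. -/
def latticeGraph : SimpleGraph (ℤ × ℤ) where
  Adj u v := |u.1 - v.1| + |u.2 - v.2| = 1
  symm := ⟨fun u v h => by rw [abs_sub_comm v.1, abs_sub_comm v.2]; exact h⟩
  loopless := ⟨fun u h => by simp at h⟩

/-- The vertex boundary of a set of vertices of a graph. -/
def vertexBoundary {V : Type*} (G : SimpleGraph V) (A : Set V) : Set V :=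
  {u | u ∉ A ∧ ∃ v ∈ A, G.Adj u v}

/-- A finite set of lattice points has a finite vertex boundary, so `Set.ncard` below counts it. -/
theorem vertexBoundary_finite (A : Finset (ℤ × ℤ)) :
    (vertexBoundary latticeGraph (A : Set (ℤ × ℤ))).Finite := by
  refine Set.Finite.subset (Set.Finite.biUnion A.finite_toSet
    (fun v _ => Set.finite_Icc (v - (1, 1)) (v + (1, 1)))) ?_
  rintro u ⟨-, v, hv, huv⟩
  have h : |u.1 - v.1| + |u.2 - v.2| = 1 := huv
  have h1 := abs_nonneg (u.1 - v.1)
  have h2 := abs_nonneg (u.2 - v.2)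
  have h3 : |u.1 - v.1| ≤ 1 := by omega
  have h4 : |u.2 - v.2| ≤ 1 := by omega
  rw [abs_le] at h3 h4
  simp only [Set.mem_iUnion]
  refine ⟨v, hv, ?_⟩
  rw [Set.mem_Icc, Prod.le_def, Prod.le_def]
  simp only [Prod.fst_sub, Prod.snd_sub, Prod.fst_add, Prod.snd_add]
  omega

/-- The size of the vertex boundary of a finite set of lattice points. -/
noncomputable def boundarySize (A : Finset (ℤ × ℤ)) : ℕ :=
  (vertexBoundary latticeGraph (A : Set (ℤ × ℤ))).ncard

/-- A minimal set: a nonempty finite set of lattice points whose vertex boundary is smallest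
among all sets with the same number of points. -/
def IsMinimal (A : Finset (ℤ × ℤ)) : Prop :=
  A.Nonempty ∧ ∀ B : Finset (ℤ × ℤ), B.card = A.card → boundarySize A ≤ boundarySize B

/-- Two sets are congruent if an automorphism of the lattice graph takes one to the other. -/
def LatticeCongruent (A B : Finset (ℤ × ℤ)) : Prop :=
  ∃ φ : latticeGraph ≃g latticeGraph, φ '' (A : Set (ℤ × ℤ)) = (B : Set (ℤ × ℤ))

theorem LatticeCongruent.card_eq {A B : Finset (ℤ × ℤ)} (h : LatticeCongruent A B) : A.card = B.card := by
  obtain ⟨φ, h⟩ := h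
  have := Set.ncard_image_of_injective (A : Set (ℤ × ℤ)) φ.injective
  rw [h, Set.ncard_coe_finset, Set.ncard_coe_finset] at this
  exact this.symm

/-! ### The graph of minimal sets -/

/-- Congruence as an equivalence relation on the minimal sets. -/
def congruenceSetoid : Setoid {A : Finset (ℤ × ℤ) // IsMinimal A} where
  r A B := LatticeCongruent A.1 B.1
  iseqv :=
    { refl := fun A => ⟨SimpleGraph.Iso.refl, by ext x; simp⟩
      symm := by
        rintro A B ⟨φ, h⟩
        refine ⟨φ.symm, ?_⟩
        rw [← h, Set.image_image]
        simp
      trans := by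
        rintro A B C ⟨φ, h⟩ ⟨ψ, h'⟩
        refine ⟨φ.trans ψ, ?_⟩
        rw [← h', ← h, Set.image_image]
        rfl }

/-- Congruence classes of minimal sets. -/
def MinimalClass : Type := Quotient congruenceSetoid

/-- The congruence class of a minimal set. -/
def minimalClass (A : Finset (ℤ × ℤ)) (hA : IsMinimal A) : MinimalClass :=
  Quotient.mk congruenceSetoid ⟨A, hA⟩

/-- `A` is a minimal set representing the class `v`. -/
def Represents (A : Finset (ℤ × ℤ)) (v : MinimalClass) : Prop :=
  ∃ hA : IsMinimal A, minimalClass A hA = v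

/-- The graph of minimal sets: two classes are joined by an edge if they have representatives
whose symmetric difference has exactly one element. -/
def minimalSetGraph : SimpleGraph MinimalClass where
  Adj v w := ∃ A B : Finset (ℤ × ℤ), Represents A v ∧ Represents B w ∧ (A ∆ B).card = 1
  symm := ⟨by
    rintro v w ⟨A, B, hA, hB, h⟩
    exact ⟨B, A, hB, hA, by rw [symmDiff_comm]; exact h⟩⟩
  loopless := ⟨by
    rintro v ⟨A, B, ⟨hA, rfl⟩, ⟨hB, hAB⟩, h⟩
    have hc : B.card = A.card := LatticeCongruent.card_eq (Quotient.exact hAB)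
    have h1 : (A ∆ B).card = (A \ B).card + (B \ A).card :=
      Finset.card_union_of_disjoint disjoint_sdiff_sdiff
    have h2 := Finset.card_sdiff_add_card_inter A B
    have h3 := Finset.card_sdiff_add_card_inter B A
    rw [Finset.inter_comm] at h3
    omega⟩

/-- The minimal sets whose congruence classes lie in a component of the graph. -/
def setsInComponent (C : minimalSetGraph.ConnectedComponent) : Set (Finset (ℤ × ℤ)) :=
  {A | ∃ v ∈ C.supp, Represents A v}

/-- The height of a component: the maximal length (number of terms) of a strictly nested sequence
of minimal sets in it. -/
noncomputable def componentHeight (C : minimalSetGraph.ConnectedComponent) : ℕ∞ :=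
  (setsInComponent C).chainHeight (· ⊂ ·)

/-! ### Boxes -/

/-- The points between the lines `y - x = a`, `y - x = b`, `y + x = c` and `y + x = d`. -/
def boxRegion (a b c d : ℤ) : Set (ℤ × ℤ) :=
  {p | (a ≤ p.2 - p.1 ∧ p.2 - p.1 ≤ b) ∧ (c ≤ p.2 + p.1 ∧ p.2 + p.1 ≤ d)}

/-- A box is a nonempty set of the form `boxRegion a b c d`. -/
def IsBox (B : Finset (ℤ × ℤ)) : Prop :=
  B.Nonempty ∧ ∃ a b c d : ℤ, (B : Set (ℤ × ℤ)) = boxRegion a b c d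

/-- The modulus of a box is the unordered pair `{b - a, d - c}`, where among all parameters
describing the box `a` and `c` are chosen maximal and `b` and `d` minimal. -/
def HasModulus (B : Finset (ℤ × ℤ)) (m : Sym2 ℤ) : Prop :=
  B.Nonempty ∧ ∃ a b c d : ℤ, (B : Set (ℤ × ℤ)) = boxRegion a b c d ∧
    (∀ a' b' c' d' : ℤ, (B : Set (ℤ × ℤ)) = boxRegion a' b' c' d' →
      a' ≤ a ∧ b ≤ b' ∧ c' ≤ c ∧ d ≤ d') ∧
    m = s(b - a, d - c)

/-- `E` is the enclosing box of `A`, the smallest box containing `A`. -/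
def IsEnclosingBox (A E : Finset (ℤ × ℤ)) : Prop :=
  IsLeast {E' : Finset (ℤ × ℤ) | IsBox E' ∧ A ⊆ E'} E

/-- The lines `y - x = w` and `y + x = w` with `w` an integer. -/
def IsStandardLine (L : Set (ℤ × ℤ)) : Prop :=
  ∃ w : ℤ, L = {p | p.2 - p.1 = w} ∨ L = {p | p.2 + p.1 = w}

/-! ### Excess and dead sets -/

/-- The differences `|A| - |B|`, for `B` minimal with a vertex boundary of the same size as
that of `A`. -/
def excessSet (A : Finset (ℤ × ℤ)) : Set ℤ :=
  {e | ∃ B : Finset (ℤ × ℤ), IsMinimal B ∧ boundarySize A = boundarySize B ∧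
    e = (A.card : ℤ) - (B.card : ℤ)}

/-- The excess of a set, the maximum of `excessSet`. -/
noncomputable def excess (A : Finset (ℤ × ℤ)) : ℤ := sSup (excessSet A)

theorem excess_isGreatest_of_nonempty {A : Finset (ℤ × ℤ)} (hA : (excessSet A).Nonempty) :
    IsGreatest (excessSet A) (excess A) := by
  have hb : BddAbove (excessSet A) := by
    refine ⟨(A.card : ℤ), ?_⟩
    rintro e ⟨B, -, -, rfl⟩
    omega
  exact ⟨Int.csSup_mem hA hb, fun e he => le_csSup hb he⟩

/-- For a minimal set the maximum defining the excess is attained. -/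
theorem IsMinimal.excess_isGreatest {A : Finset (ℤ × ℤ)} (hA : IsMinimal A) :
    IsGreatest (excessSet A) (excess A) :=
  excess_isGreatest_of_nonempty ⟨_, A, hA, rfl, rfl⟩

/-- The life expectancy of `A`: the largest `n` for which there are nested minimal sets
`A = A₀ ⊆ A₁ ⊆ ⋯ ⊆ Aₙ` with `|Aᵢ| = |A| + i`. -/
noncomputable def lifeExpectancy (A : Finset (ℤ × ℤ)) : ℕ∞ :=
  ⨆ (n : ℕ) (_ : ∃ s : Fin (n + 1) → Finset (ℤ × ℤ), s 0 = A ∧ Monotone s ∧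
    ∀ i, IsMinimal (s i) ∧ (s i).card = A.card + (i : ℕ)), (n : ℕ∞)

/-- A dead set is a minimal set of life expectancy zero. -/
def IsDead (A : Finset (ℤ × ℤ)) : Prop :=
  IsMinimal A ∧ lifeExpectancy A = 0

/-!
In the diagonal coordinates `u = y - x` and `v = y + x`, the four unit vectors form the sumset of
two pairs, one pair with the same `u` and the other with the same `v`. Adding the first pair to a
set `S` gains a point on every line of constant `u` that meets `S`, adding the second gains a point
on every line of constant `v`, so the neighbours of `S` number at least `|S| + |u(S)| + |v(S)| + 1`.
Neighbours have the opposite checkerboard colour, and applying the bound to both colours of a set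
`A` gives `|∂A| ≥ |u(A)| + |v(A)| + 2`, with equality for boxes.

Let `B` be a dead box of excess `d` all of whose lines have at least `d + 2` points. A subset of `B`
missing at most `d + 1` points still meets every line of `B`, so if it is minimal it has the same
boundary size as `B`, and by the definition of the excess it misses at most `d` points. Going up, a
minimal set with one more point than such a proper subset has boundary size at most `|∂B|` and meets
all lines of `B`; then it meets no others, and so lies in `B`. From `B` itself there is no way up
because `B` is dead. Hence the component of `B` consists of subsets of `B` that miss at most `d`
points, and all these sizes occur, since one can always remove a point of a set without increasing
its boundary.

Examples come from the sharp inequality `8 |A| ≤ (|∂A| - 2) ^ 2 + 4`, which follows from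
`|S| ≤ |u(S)| |v(S)|` on each colour. By it, sets with more than `s.choose 2` points have boundary
size at least `2 s + 2`, so a box of boundary size `2 s + 2` with `s.choose 2 + 1 + d` points is
minimal of excess `d`. If its lines are long, it is dead as soon as some larger set has no larger
boundary, because then a minimal set containing it with one more point would have to lie inside it.
-/

section Diagonal

/-- The first diagonal coordinate `y - x` of a lattice point. -/
def diagU : ℤ × ℤ →+ ℤ := AddMonoidHom.snd ℤ ℤ - AddMonoidHom.fst ℤ ℤ

/-- The second diagonal coordinate `y + x` of a lattice point. -/
def diagV : ℤ × ℤ →+ ℤ := AddMonoidHom.snd ℤ ℤ + AddMonoidHom.fst ℤ ℤ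

/-- The lattice point with diagonal coordinates `u` and `v`, which have to be of the same parity. -/
def ofDiag (u v : ℤ) : ℤ × ℤ := ((v - u) / 2, (v + u) / 2)

theorem diagU_apply (p : ℤ × ℤ) : diagU p = p.2 - p.1 := rfl

theorem diagV_apply (p : ℤ × ℤ) : diagV p = p.2 + p.1 := rfl

theorem diagU_ofDiag {u v : ℤ} (h : 2 ∣ v - u) : diagU (ofDiag u v) = u := by
  simp only [diagU_apply, ofDiag]
  omega

theorem diagV_ofDiag {u v : ℤ} (h : 2 ∣ v - u) : diagV (ofDiag u v) = v := by
  simp only [diagV_apply, ofDiag]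
  omega

theorem diag_ext {p q : ℤ × ℤ} (hu : diagU p = diagU q) (hv : diagV p = diagV q) : p = q := by
  simp only [diagU_apply, diagV_apply] at hu hv
  ext <;> omega

theorem two_dvd_diagV_sub_diagU (p : ℤ × ℤ) : 2 ∣ diagV p - diagU p :=
  ⟨p.1, by simp only [diagU_apply, diagV_apply]; ring⟩

theorem mem_boxRegion {a b c d : ℤ} {p : ℤ × ℤ} : p ∈ boxRegion a b c d ↔
    (a ≤ diagU p ∧ diagU p ≤ b) ∧ (c ≤ diagV p ∧ diagV p ≤ d) :=
  Iff.rfl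

theorem latticeGraph_adj_iff {p q : ℤ × ℤ} : latticeGraph.Adj p q ↔
    (diagU p = diagU q + 1 ∨ diagU p = diagU q - 1) ∧
      (diagV p = diagV q + 1 ∨ diagV p = diagV q - 1) := by
  change |p.1 - q.1| + |p.2 - q.2| = 1 ↔ _
  simp only [diagU_apply, diagV_apply]
  rcases abs_cases (p.1 - q.1) with h | h <;> rcases abs_cases (p.2 - q.2) with h' | h' <;> omega

end Diagonal

section Neighbours

open scoped Pointwise

-- In each fibre of `f`, the point of `S` with the largest `g`, translated by `y`, lies above all of
-- `S + x`.
theorem card_add_card_image_le_card_add_pair {G H L : Type*} [AddRightCancelMonoid G]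
    [DecidableEq G] [AddRightCancelMonoid H] [DecidableEq H] [AddMonoid L] [LinearOrder L]
    [AddLeftStrictMono L] [AddRightMono L] (f : G →+ H) (g : G →+ L) {x y : G}
    (hf : f x = f y) (hg : g x < g y) (S : Finset G) :
    S.card + (S.image f).card ≤ (S + {x, y}).card := by
  have exists_top : ∀ w ∈ S.image f, ∃ a ∈ S, f a = w ∧ ∀ b ∈ S, f b = w → g b ≤ g a := by
    intro w hw
    obtain ⟨c, hc, rfl⟩ := Finset.mem_image.1 hw
    obtain ⟨a, ha, hmax⟩ := (S.filter fun b => f b = f c).exists_max_image g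
      ⟨c, Finset.mem_filter.2 ⟨hc, rfl⟩⟩
    rw [Finset.mem_filter] at ha
    exact ⟨a, ha.1, ha.2, fun b hb hbw => hmax b (Finset.mem_filter.2 ⟨hb, hbw⟩)⟩
  choose! top top_mem f_top top_max using exists_top
  have card_top : ((S.image f).image fun w => top w + y).card = (S.image f).card :=
    Finset.card_image_of_injOn fun w hw w' hw' h => by
      rw [← f_top w hw, ← f_top w' hw', add_right_cancel h]
  have card_translate : (S.image (· + x)).card = S.card :=
    Finset.card_image_of_injective _ (add_left_injective x)
  have disjoint_top : Disjoint (S.image (· + x)) ((S.image f).image fun w => top w + y) := by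
    simp only [Finset.disjoint_left, Finset.mem_image]
    rintro _ ⟨a, ha, rfl⟩ ⟨w, hw, h⟩
    have hw := Finset.mem_image.2 hw
    have hfa : f a = w := by
      have := congrArg f h
      rwa [map_add, map_add, hf, add_left_inj, f_top w hw, eq_comm] at this
    have hga := congrArg g h
    rw [map_add, map_add] at hga
    exact absurd hga (add_lt_add_of_le_of_lt (top_max w hw a ha hfa) hg).ne'
  rw [← card_top, ← card_translate, ← Finset.card_union_of_disjoint disjoint_top]
  refine Finset.card_le_card (Finset.union_subset ?_ ?_) <;>
    simp only [Finset.subset_iff, Finset.mem_image]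
  · rintro _ ⟨a, ha, rfl⟩
    exact Finset.add_mem_add ha (by simp)
  · rintro _ ⟨w, hw, rfl⟩
    exact Finset.add_mem_add (top_mem w (Finset.mem_image.2 hw)) (by simp)

/-- The points adjacent to a point of `S`, some of which may lie in `S`. -/
def latticeNeighbors (S : Finset (ℤ × ℤ)) : Finset (ℤ × ℤ) :=
  S + {(1, 0), (-1, 0), (0, 1), (0, -1)}

theorem mem_latticeNeighbors {S : Finset (ℤ × ℤ)} {p : ℤ × ℤ} :
    p ∈ latticeNeighbors S ↔ ∃ a ∈ S, latticeGraph.Adj p a := by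
  have mem_unit_vectors (e : ℤ × ℤ) :
      e ∈ ({(1, 0), (-1, 0), (0, 1), (0, -1)} : Finset (ℤ × ℤ)) ↔ |e.1| + |e.2| = 1 := by
    simp only [Finset.mem_insert, Finset.mem_singleton, Prod.ext_iff]
    rcases abs_cases e.1 with h | h <;> rcases abs_cases e.2 with h' | h' <;> omega
  rw [latticeNeighbors, Finset.mem_add]
  refine exists_congr fun a => and_congr_right fun _ => ?_
  constructor
  · rintro ⟨e, he, rfl⟩
    simpa [latticeGraph, mem_unit_vectors] using he
  · exact fun h => ⟨p - a, (mem_unit_vectors _).2 h, add_sub_cancel a p⟩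

theorem latticeNeighbors_eq_add_pair (S : Finset (ℤ × ℤ)) :
    latticeNeighbors S = S + {(0, 0), (1, 1)} + {(0, -1), (-1, 0)} := by
  rw [latticeNeighbors, add_assoc]
  exact congrArg (S + ·) (by decide)

theorem card_add_card_images_lt_card_latticeNeighbors {S : Finset (ℤ × ℤ)} (hS : S.Nonempty) :
    S.card + (S.image diagU).card + (S.image diagV).card + 1 ≤ (latticeNeighbors S).card := by
  set T : Finset (ℤ × ℤ) := S + {(0, 0), (1, 1)}
  have card_T : S.card + (S.image diagU).card ≤ T.card :=
    card_add_card_image_le_card_add_pair diagU diagV (by decide) (by decide) S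
  have card_neighbors : T.card + (T.image diagV).card ≤ (latticeNeighbors S).card := by
    rw [latticeNeighbors_eq_add_pair]
    exact card_add_card_image_le_card_add_pair diagV diagU (by decide) (by decide) T
  have image_T : (S.image diagV).card + 1 ≤ (T.image diagV).card := by
    rw [Finset.image_add]
    have := cauchy_davenport_add_of_linearOrder_isCancelAdd (hS.image diagV)
      (t := ({(0, 0), (1, 1)} : Finset (ℤ × ℤ)).image diagV) (by simp)
    rwa [show (({(0, 0), (1, 1)} : Finset (ℤ × ℤ)).image diagV).card = 2 by decide] at this
  omega

end Neighbours

section Isoperimetry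

theorem boundarySize_eq_card_sdiff (A : Finset (ℤ × ℤ)) :
    boundarySize A = (latticeNeighbors A \ A).card := by
  rw [boundarySize, ← Set.ncard_coe_finset]
  congr 1
  ext p
  simp only [vertexBoundary, Set.mem_ofPred_eq, Finset.coe_sdiff, Set.mem_sdiff, Finset.mem_coe,
    mem_latticeNeighbors, and_comm]

theorem card_add_boundarySize (A : Finset (ℤ × ℤ)) :
    A.card + boundarySize A = (A ∪ latticeNeighbors A).card := by
  rw [boundarySize_eq_card_sdiff, ← Finset.card_union_of_disjoint Finset.disjoint_sdiff,
    Finset.union_sdiff_self_eq_union]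

/-- The part of `A` on one colour of the checkerboard, the points with `y - x` even. -/
def evenPart (A : Finset (ℤ × ℤ)) : Finset (ℤ × ℤ) := A.filter fun p => Even (diagU p)

/-- The part of `A` on the other colour of the checkerboard, the points with `y - x` odd. -/
def oddPart (A : Finset (ℤ × ℤ)) : Finset (ℤ × ℤ) := A.filter fun p => ¬ Even (diagU p)

theorem evenPart_union_oddPart (A : Finset (ℤ × ℤ)) : evenPart A ∪ oddPart A = A :=
  Finset.filter_union_filter_not_eq _ A

theorem card_evenPart_add_card_oddPart (A : Finset (ℤ × ℤ)) :
    (evenPart A).card + (oddPart A).card = A.card :=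
  Finset.card_filter_add_card_filter_not _

theorem even_diagU_of_adj {p q : ℤ × ℤ} (h : latticeGraph.Adj p q) :
    Even (diagU p) ↔ ¬ Even (diagU q) := by
  rcases (latticeGraph_adj_iff.1 h).1 with h | h <;> rw [h] <;> grind

theorem evenPart_latticeNeighbors (A : Finset (ℤ × ℤ)) :
    evenPart (latticeNeighbors A) = latticeNeighbors (oddPart A) := by
  ext p
  simp only [evenPart, oddPart, Finset.mem_filter, mem_latticeNeighbors]
  grind [even_diagU_of_adj]

theorem oddPart_latticeNeighbors (A : Finset (ℤ × ℤ)) :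
    oddPart (latticeNeighbors A) = latticeNeighbors (evenPart A) := by
  ext p
  simp only [evenPart, oddPart, Finset.mem_filter, mem_latticeNeighbors]
  grind [even_diagU_of_adj]

theorem card_add_boundarySize_eq_checkerboard (A : Finset (ℤ × ℤ)) :
    A.card + boundarySize A = (oddPart A ∪ latticeNeighbors (evenPart A)).card +
      (evenPart A ∪ latticeNeighbors (oddPart A)).card := by
  rw [card_add_boundarySize, ← card_evenPart_add_card_oddPart, add_comm,
    ← evenPart_latticeNeighbors, ← oddPart_latticeNeighbors]
  simp only [evenPart, oddPart, Finset.filter_union]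

theorem card_image_add_card_image_add_two_le_boundarySize {A : Finset (ℤ × ℤ)}
    (hA : A.Nonempty) :
    (A.image diagU).card + (A.image diagV).card + 2 ≤ boundarySize A := by
  have card_image_le_parts (f : ℤ × ℤ →+ ℤ) :
      (A.image f).card ≤ ((evenPart A).image f).card + ((oddPart A).image f).card := by
    conv_lhs => rw [← evenPart_union_oddPart A, Finset.image_union]
    exact Finset.card_union_le _ _
  have card_side (S T : Finset (ℤ × ℤ)) : T.card ≤ (T ∪ latticeNeighbors S).card ∧
      (S.image diagU).card ≤ S.card ∧ (S.image diagV).card ≤ S.card ∧ (0 < S.card →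
        S.card + (S.image diagU).card + (S.image diagV).card + 1 ≤
          (T ∪ latticeNeighbors S).card) :=
    ⟨Finset.card_le_card Finset.subset_union_left, Finset.card_image_le, Finset.card_image_le,
      fun hS => (card_add_card_images_lt_card_latticeNeighbors (Finset.card_pos.1 hS)).trans
        (Finset.card_le_card Finset.subset_union_right)⟩
  have := card_image_le_parts diagU
  have := card_image_le_parts diagV
  have := card_side (evenPart A) (oddPart A)
  have := card_side (oddPart A) (evenPart A)
  have := card_add_boundarySize_eq_checkerboard A
  have := card_evenPart_add_card_oddPart A
  have := hA.card_pos
  omega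

/-- The least natural number not below `2√n`, a lower bound for the sum of two natural numbers
with product at least `n`. -/
noncomputable def ceilTwoSqrt (n : ℕ) : ℕ := ⌈2 * √(n : ℝ)⌉₊

theorem ceilTwoSqrt_le_iff {n s : ℕ} : ceilTwoSqrt n ≤ s ↔ 4 * n ≤ s ^ 2 := by
  rw [ceilTwoSqrt, Nat.ceil_le, ← Nat.cast_le (α := ℝ)]
  push_cast
  rw [← Real.sqrt_le_left (by positivity), Real.sqrt_mul (by norm_num),
    show √(4 : ℝ) = 2 by rw [show (4 : ℝ) = 2 ^ 2 by norm_num, Real.sqrt_sq (by norm_num)]]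

theorem card_le_card_image_mul_card_image (A : Finset (ℤ × ℤ)) :
    A.card ≤ (A.image diagU).card * (A.image diagV).card := by
  rw [← Finset.card_product]
  refine Finset.card_le_card_of_injOn (fun p => (diagU p, diagV p)) (fun p hp => ?_)
    fun p _ q _ h => diag_ext (congrArg Prod.fst h) (congrArg Prod.snd h)
  exact Finset.mem_product.2 ⟨Finset.mem_image_of_mem _ hp, Finset.mem_image_of_mem _ hp⟩

theorem card_add_ceilTwoSqrt_lt_card_latticeNeighbors {S : Finset (ℤ × ℤ)} (hS : S.Nonempty) :
    S.card + ceilTwoSqrt S.card + 1 ≤ (latticeNeighbors S).card := by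
  have am_gm : 4 * S.card ≤ ((S.image diagU).card + (S.image diagV).card) ^ 2 :=
    (Nat.mul_le_mul_left 4 (card_le_card_image_mul_card_image S)).trans <| by
      simpa only [mul_assoc] using four_mul_le_sq_add _ _
  have := ceilTwoSqrt_le_iff.2 am_gm
  have := card_add_card_images_lt_card_latticeNeighbors hS
  omega

theorem eight_mul_add_le_sq_of_le_add_ceilTwoSqrt {p q b : ℕ} (hqp : q ≤ p)
    (hpq : p ≤ q + ceilTwoSqrt q) (hb : ceilTwoSqrt p + ceilTwoSqrt q + 2 ≤ b) :
    8 * ((p : ℤ) + q) ≤ ((b : ℤ) - 2) ^ 2 + 4 := by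
  have hs : 4 * p ≤ ceilTwoSqrt p ^ 2 := ceilTwoSqrt_le_iff.1 le_rfl
  have ht : 4 * q ≤ ceilTwoSqrt q ^ 2 := ceilTwoSqrt_le_iff.1 le_rfl
  have t_le_s : ceilTwoSqrt q ≤ ceilTwoSqrt p := ceilTwoSqrt_le_iff.2 (by omega)
  have s_le_t : ceilTwoSqrt p ≤ ceilTwoSqrt q + 2 := ceilTwoSqrt_le_iff.2 (by linarith)
  generalize ceilTwoSqrt p = s at *
  generalize ceilTwoSqrt q = t at *
  zify at hs ht t_le_s s_le_t hb
  have sq_diff : ((s : ℤ) - t) ^ 2 ≤ 2 ^ 2 := pow_le_pow_left₀ (by omega) (by omega) 2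
  have sq_sum : ((s : ℤ) + t) ^ 2 ≤ (b - 2) ^ 2 := pow_le_pow_left₀ (by positivity) (by omega) 2
  linarith [add_sq (s : ℤ) t, sub_sq (s : ℤ) t]

theorem eight_mul_add_le_sq_of_add_ceilTwoSqrt_lt {p q b : ℕ}
    (hpq : q + ceilTwoSqrt q < p) (hb : p + ceilTwoSqrt p + 1 ≤ q + b) :
    8 * ((p : ℤ) + q) ≤ ((b : ℤ) - 2) ^ 2 + 4 := by
  have hs : 4 * p ≤ ceilTwoSqrt p ^ 2 := ceilTwoSqrt_le_iff.1 le_rfl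
  have ht : 4 * q ≤ ceilTwoSqrt q ^ 2 := ceilTwoSqrt_le_iff.1 le_rfl
  obtain ⟨y, rfl⟩ : ∃ y, p = q + y + 1 := ⟨p - q - 1, by omega⟩
  have sq_y : ceilTwoSqrt q ^ 2 ≤ y ^ 2 := Nat.pow_le_pow_left (by omega) 2
  have s_le : ceilTwoSqrt (q + y + 1) ≤ y + 2 := ceilTwoSqrt_le_iff.2 (by linarith)
  have two_le_s : 2 ≤ ceilTwoSqrt (q + y + 1) := by nlinarith
  generalize ceilTwoSqrt (q + y + 1) = s at *
  zify at hs s_le two_le_s hb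
  have sq_b : ((y : ℤ) + s) ^ 2 ≤ (b - 2) ^ 2 := pow_le_pow_left₀ (by positivity) (by omega) 2
  have sq_s : ((s : ℤ) + s) ^ 2 ≤ (y + 2 + s) ^ 2 := pow_le_pow_left₀ (by positivity) (by omega) 2
  push_cast
  linarith

theorem eight_mul_add_le_sq_of_ceilTwoSqrt {p q P Q b : ℕ} (hqp : q ≤ p)
    (hP : 0 < p → p + ceilTwoSqrt p + 1 ≤ P) (hQ : 0 < q → q + ceilTwoSqrt q + 1 ≤ Q)
    (hpQ : p ≤ Q) (hb : p + q + b = P + Q) :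
    8 * ((p : ℤ) + q) ≤ ((b : ℤ) - 2) ^ 2 + 4 := by
  rcases p.eq_zero_or_pos with rfl | hp
  · obtain rfl := Nat.le_zero.1 hqp
    push_cast
    positivity
  specialize hP hp
  rcases le_or_gt p (q + ceilTwoSqrt q) with hpq | hpq
  · have hq : 0 < q := by
      rcases q.eq_zero_or_pos with rfl | hq
      · have : ceilTwoSqrt 0 ≤ 0 := ceilTwoSqrt_le_iff.2 (by simp)
        omega
      · exact hq
    specialize hQ hq
    exact eight_mul_add_le_sq_of_le_add_ceilTwoSqrt hqp hpq (by omega)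
  · exact eight_mul_add_le_sq_of_add_ceilTwoSqrt_lt hpq (by omega)

theorem eight_mul_card_le_sq (A : Finset (ℤ × ℤ)) :
    8 * (A.card : ℤ) ≤ ((boundarySize A : ℤ) - 2) ^ 2 + 4 := by
  have card_neighbors (S T : Finset (ℤ × ℤ)) (hS : 0 < S.card) :
      S.card + ceilTwoSqrt S.card + 1 ≤ (T ∪ latticeNeighbors S).card :=
    (card_add_ceilTwoSqrt_lt_card_latticeNeighbors (Finset.card_pos.1 hS)).trans
      (Finset.card_le_card Finset.subset_union_right)
  have card_sides := card_add_boundarySize_eq_checkerboard A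
  rw [← card_evenPart_add_card_oddPart A] at card_sides ⊢
  push_cast
  rcases le_total (oddPart A).card (evenPart A).card with h | h
  · exact eight_mul_add_le_sq_of_ceilTwoSqrt h (card_neighbors _ _) (card_neighbors _ _)
      (Finset.card_le_card Finset.subset_union_left) card_sides
  · rw [add_comm]
    exact eight_mul_add_le_sq_of_ceilTwoSqrt h (card_neighbors _ (evenPart A))
      (card_neighbors _ (oddPart A))
      (Finset.card_le_card Finset.subset_union_left) (by omega)

end Isoperimetry

section Removal

theorem exists_boundarySize_erase_le {A : Finset (ℤ × ℤ)} (hA : A.Nonempty) :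
    ∃ a ∈ A, boundarySize (A.erase a) ≤ boundarySize A := by
  obtain ⟨a, ha, hmin⟩ := A.exists_min_image Prod.fst hA
  refine ⟨a, ha, ?_⟩
  have left_not_mem : a - (1, 0) ∉ A.erase a ∪ latticeNeighbors (A.erase a) := by
    rw [Finset.mem_union, mem_latticeNeighbors, Finset.mem_erase]
    rintro (⟨-, h⟩ | ⟨c, hc, h⟩)
    · have := hmin _ h
      simp at this
    · rw [Finset.mem_erase] at hc
      have := hmin c hc.2
      rw [latticeGraph_adj_iff] at h
      simp only [diagU_apply, diagV_apply, Prod.fst_sub, Prod.snd_sub] at h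
      exact hc.1 (Prod.ext (by omega) (by omega))
  have left_mem : a - (1, 0) ∈ A ∪ latticeNeighbors A := by
    rw [Finset.mem_union, mem_latticeNeighbors]
    exact Or.inr ⟨a, ha, by simp [latticeGraph]⟩
  have ssubset : A.erase a ∪ latticeNeighbors (A.erase a) ⊂ A ∪ latticeNeighbors A := by
    refine Finset.ssubset_iff_subset_ne.2 ⟨Finset.union_subset_union (Finset.erase_subset a A)
      fun p hp => ?_, fun h => left_not_mem (h ▸ left_mem)⟩
    obtain ⟨c, hc, h⟩ := mem_latticeNeighbors.1 hp
    exact mem_latticeNeighbors.2 ⟨c, Finset.mem_of_mem_erase hc, h⟩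
  have := Finset.card_lt_card ssubset
  rw [← card_add_boundarySize, ← card_add_boundarySize] at this
  have := Finset.card_erase_add_one ha
  omega

theorem exists_monotone_boundarySize_le (A : Finset (ℤ × ℤ)) :
    ∃ s : ℕ → Finset (ℤ × ℤ), Monotone s ∧ s A.card = A ∧
      ∀ k ≤ A.card, (s k).card = k ∧ boundarySize (s k) ≤ boundarySize A := by
  induction hn : A.card generalizing A with
  | zero => exact ⟨fun _ => A, monotone_const, rfl, fun k hk => ⟨hn.trans (by omega), le_rfl⟩⟩
  | succ n ih =>
    obtain ⟨a, ha, hle⟩ := exists_boundarySize_erase_le (Finset.card_pos.1 (by omega : 0 < A.card))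
    obtain ⟨s, hs, hsn, hs'⟩ := ih (A.erase a) (by rw [Finset.card_erase_of_mem ha, hn]; rfl)
    refine ⟨fun k => if k ≤ n then s k else A, fun k l hkl => ?_, if_neg (by omega),
      fun k hk => ?_⟩
    · dsimp only
      split_ifs with hk hl hl
      · exact hs hkl
      · exact ((hs hk).trans_eq hsn).trans (Finset.erase_subset a A)
      · omega
      · exact le_rfl
    · dsimp only
      split_ifs with hkn
      · exact ⟨(hs' k hkn).1, (hs' k hkn).2.trans hle⟩
      · exact ⟨by omega, le_rfl⟩

theorem IsMinimal.boundarySize_le {A B : Finset (ℤ × ℤ)} (hA : IsMinimal A)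
    (h : A.card ≤ B.card) : boundarySize A ≤ boundarySize B := by
  obtain ⟨s, -, -, hs⟩ := exists_monotone_boundarySize_le B
  exact (hA.2 _ (hs _ h).1).trans (hs _ h).2

end Removal

section Automorphisms

theorem vertexBoundary_image {V : Type*} {G : SimpleGraph V} (φ : G ≃g G) (A : Set V) :
    vertexBoundary G (φ '' A) = φ '' vertexBoundary G A := by
  ext u
  obtain ⟨u, rfl⟩ := φ.surjective u
  simp only [vertexBoundary, Set.mem_ofPred_eq, φ.injective.mem_set_image, Set.exists_mem_image,
    φ.map_adj_iff]

theorem boundarySize_image (φ : latticeGraph ≃g latticeGraph) (A : Finset (ℤ × ℤ)) :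
    boundarySize (A.image φ) = boundarySize A := by
  rw [boundarySize, boundarySize, Finset.coe_image, vertexBoundary_image,
    Set.ncard_image_of_injective _ φ.injective]

theorem latticeCongruent_iff {A B : Finset (ℤ × ℤ)} : LatticeCongruent A B ↔
    ∃ φ : latticeGraph ≃g latticeGraph, A.image φ = B := by
  refine exists_congr fun φ => ?_
  rw [← Finset.coe_inj, Finset.coe_image]

theorem IsMinimal.image {A : Finset (ℤ × ℤ)} (hA : IsMinimal A)
    (φ : latticeGraph ≃g latticeGraph) : IsMinimal (A.image φ) := by
  refine ⟨hA.1.image _, fun B hB => ?_⟩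
  rw [boundarySize_image]
  exact hA.2 B (hB.trans (Finset.card_image_of_injective _ φ.injective))

/-- The closed ball of radius `r` around `p` in the graph metric of the lattice. -/
def latticeBall (p : ℤ × ℤ) (r : ℕ) : Set (ℤ × ℤ) :=
  boxRegion (diagU p - r) (diagU p + r) (diagV p - r) (diagV p + r)

theorem mem_latticeBall_zero {p q : ℤ × ℤ} : q ∈ latticeBall p 0 ↔ q = p := by
  rw [latticeBall, mem_boxRegion]
  refine ⟨fun h => diag_ext (by omega) (by omega), ?_⟩
  rintro rfl
  omega

theorem mem_latticeBall_succ {p q : ℤ × ℤ} {r : ℕ} : q ∈ latticeBall p (r + 1) ↔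
    q ∈ latticeBall p r ∨ ∃ q' ∈ latticeBall p r, latticeGraph.Adj q q' := by
  simp only [latticeBall, mem_boxRegion, latticeGraph_adj_iff]
  push_cast
  refine ⟨fun h => ?_, ?_⟩
  · have hp := two_dvd_diagV_sub_diagU p
    have hq := two_dvd_diagV_sub_diagU q
    let towards (x y : ℤ) : ℤ := if x < y then x + 1 else x - 1
    have hpar : 2 ∣ towards (diagV q) (diagV p) - towards (diagU q) (diagU p) := by
      simp only [towards]
      split_ifs <;> omega
    refine or_iff_not_imp_left.2 fun hr =>
      ⟨ofDiag (towards (diagU q) (diagU p)) (towards (diagV q) (diagV p)), ?_⟩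
    rw [diagU_ofDiag hpar, diagV_ofDiag hpar]
    simp only [towards]
    split_ifs <;> omega
  · rintro (h | ⟨q', hq', h⟩) <;> omega

theorem apply_mem_latticeBall (φ : latticeGraph ≃g latticeGraph) {p q : ℤ × ℤ} {r : ℕ} :
    φ q ∈ latticeBall (φ p) r ↔ q ∈ latticeBall p r := by
  induction r generalizing q with
  | zero => rw [mem_latticeBall_zero, mem_latticeBall_zero, φ.injective.eq_iff]
  | succ r ih =>
    rw [mem_latticeBall_succ, mem_latticeBall_succ, φ.surjective.exists]
    simp only [ih, φ.map_adj_iff]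

theorem image_latticeBall (φ : latticeGraph ≃g latticeGraph) (p : ℤ × ℤ) (r : ℕ) :
    φ '' latticeBall p r = latticeBall (φ p) r := by
  ext q
  obtain ⟨q, rfl⟩ := φ.surjective q
  rw [φ.injective.mem_set_image, apply_mem_latticeBall]

theorem boxRegion_inter (a b c d a' b' c' d' : ℤ) :
    boxRegion a b c d ∩ boxRegion a' b' c' d' =
      boxRegion (max a a') (min b b') (max c c') (min d d') := by
  ext p
  simp only [Set.mem_inter_iff, mem_boxRegion]
  omega

theorem exists_boxRegion_eq_inter_latticeBall {a b c d : ℤ} (hab : a ≤ b) (hcd : c ≤ d) :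
    ∃ (p q p' q' : ℤ × ℤ) (r : ℕ), boxRegion a b c d =
      latticeBall p r ∩ latticeBall q r ∩ (latticeBall p' r ∩ latticeBall q' r) := by
  obtain ⟨r, hr⟩ := Int.eq_ofNat_of_zero_le (a := (b - a) + (d - c) + 1) (by omega)
  refine ⟨ofDiag (a + r) (c + (a + r - c) % 2), ofDiag (b - r) (c + (b - r - c) % 2),
    ofDiag (a + (c + r - a) % 2) (c + r), ofDiag (a + (d - r - a) % 2) (d - r), r, ?_⟩
  ext x
  simp (disch := omega) only [latticeBall, Set.mem_inter_iff, mem_boxRegion, diagU_ofDiag,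
    diagV_ofDiag]
  omega

theorem IsBox.image {B : Finset (ℤ × ℤ)} (hB : IsBox B) (φ : latticeGraph ≃g latticeGraph) :
    IsBox (B.image φ) := by
  obtain ⟨hne, a, b, c, d, hB⟩ := hB
  obtain ⟨x, hx⟩ : (boxRegion a b c d).Nonempty := by rwa [← hB, Finset.coe_nonempty]
  obtain ⟨⟨hax, hxb⟩, hcx, hxd⟩ := mem_boxRegion.1 hx
  obtain ⟨p, q, p', q', r, h⟩ :=
    exists_boxRegion_eq_inter_latticeBall (hax.trans hxb) (hcx.trans hxd)
  refine ⟨hne.image φ, ?_⟩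
  rw [Finset.coe_image, hB, h]
  simp only [Set.image_inter φ.injective, image_latticeBall]
  simp only [latticeBall, boxRegion_inter]
  exact ⟨_, _, _, _, rfl⟩

theorem image_symm_image (φ : latticeGraph ≃g latticeGraph) (A : Finset (ℤ × ℤ)) :
    (A.image φ).image φ.symm = A := by
  simp [Finset.image_image, Function.comp_def]

theorem IsEnclosingBox.image {A E : Finset (ℤ × ℤ)} (h : IsEnclosingBox A E)
    (φ : latticeGraph ≃g latticeGraph) : IsEnclosingBox (A.image φ) (E.image φ) := by
  refine ⟨⟨h.1.1.image φ, Finset.image_subset_image h.1.2⟩, ?_⟩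
  rintro E' ⟨hbox, hsub⟩
  have h' : E ≤ E'.image φ.symm := by
    refine h.2 ⟨hbox.image φ.symm, ?_⟩
    rw [← image_symm_image φ A]
    exact Finset.image_subset_image hsub
  rw [← image_symm_image φ.symm E']
  exact Finset.image_subset_image h'

theorem card_image_symmDiff_image (φ : latticeGraph ≃g latticeGraph) (A B : Finset (ℤ × ℤ)) :
    ((A.image φ) ∆ (B.image φ)).card = (A ∆ B).card := by
  rw [← Finset.image_symmDiff _ _ φ.injective, Finset.card_image_of_injective _ φ.injective]

theorem represents_minimalClass {A : Finset (ℤ × ℤ)} (hA : IsMinimal A) :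
    Represents A (minimalClass A hA) := ⟨hA, rfl⟩

theorem Represents.image {A : Finset (ℤ × ℤ)} {v : MinimalClass} (h : Represents A v)
    (φ : latticeGraph ≃g latticeGraph) : Represents (A.image φ) v := by
  obtain ⟨hA, rfl⟩ := h
  exact ⟨hA.image φ, Quotient.sound (latticeCongruent_iff.2 ⟨φ.symm, image_symm_image φ A⟩)⟩

theorem Represents.exists_image_eq {A B : Finset (ℤ × ℤ)} {v : MinimalClass}
    (hA : Represents A v) (hB : Represents B v) :
    ∃ φ : latticeGraph ≃g latticeGraph, A.image φ = B := by
  obtain ⟨hA, rfl⟩ := hA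
  obtain ⟨hB, h⟩ := hB
  exact latticeCongruent_iff.1 (Quotient.exact h.symm)

theorem Represents.exists_of_adj {A : Finset (ℤ × ℤ)} {v w : MinimalClass}
    (hA : Represents A v) (h : minimalSetGraph.Adj v w) :
    ∃ A', Represents A' w ∧ (A ∆ A').card = 1 := by
  obtain ⟨A₀, A₁, h₀, h₁, hcard⟩ := h
  obtain ⟨φ, rfl⟩ := h₀.exists_image_eq hA
  exact ⟨A₁.image φ, h₁.image φ, by rwa [card_image_symmDiff_image]⟩

end Automorphisms

section Boxes

theorem mem_of_coe_eq_boxRegion {B : Finset (ℤ × ℤ)} {a b c d : ℤ}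
    (hB : (B : Set (ℤ × ℤ)) = boxRegion a b c d) {p : ℤ × ℤ} :
    p ∈ B ↔ (a ≤ diagU p ∧ diagU p ≤ b) ∧ (c ≤ diagV p ∧ diagV p ≤ d) := by
  rw [← Finset.mem_coe, hB, mem_boxRegion]

theorem IsBox.mem_iff {B : Finset (ℤ × ℤ)} (hB : IsBox B) {p : ℤ × ℤ} :
    p ∈ B ↔ diagU p ∈ B.image diagU ∧ diagV p ∈ B.image diagV := by
  refine ⟨fun hp => ⟨Finset.mem_image_of_mem _ hp, Finset.mem_image_of_mem _ hp⟩, ?_⟩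
  obtain ⟨-, a, b, c, d, hB⟩ := hB
  simp only [Finset.mem_image, mem_of_coe_eq_boxRegion hB]
  rintro ⟨⟨q, hq, hqp⟩, r, hr, hrp⟩
  omega

theorem isEnclosingBox_of_image_subset {A B : Finset (ℤ × ℤ)} (hB : IsBox B) (hAB : A ⊆ B)
    (hU : B.image diagU ⊆ A.image diagU) (hV : B.image diagV ⊆ A.image diagV) :
    IsEnclosingBox A B := by
  refine ⟨⟨hB, hAB⟩, ?_⟩
  rintro E ⟨hE, hAE⟩ p hp
  exact hE.mem_iff.2 ⟨Finset.image_subset_image hAE (hU (Finset.mem_image_of_mem _ hp)),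
    Finset.image_subset_image hAE (hV (Finset.mem_image_of_mem _ hp))⟩

theorem boundarySize_box_le {B : Finset (ℤ × ℤ)} {a b c d : ℤ}
    (hB : (B : Set (ℤ × ℤ)) = boxRegion a b c d) (hab : a ≤ b) (hcd : c ≤ d) :
    (boundarySize B : ℤ) ≤ (b - a) + (d - c) + 4 := by
  -- In diagonal coordinates the boundary lies on a rectangular frame, and `t q` is the position of
  -- `q` on a tour of it. Only every second position is a lattice point, so `t q / 2` determines
  -- `q`.
  let t : ℤ × ℤ → ℤ := fun q =>
    if diagV q = c - 1 then diagU q - (a - 1)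
    else if diagU q = b + 1 then (b - a + 2) + (diagV q - (c - 1))
    else if diagV q = d + 1 then (b - a + 2) + (d - c + 2) + (b + 1 - diagU q)
    else 2 * (b - a + 2) + (d - c + 2) + (d + 1 - diagV q)
  have on_frame : ∀ q ∈ latticeNeighbors B \ B, (a - 1 ≤ diagU q ∧ diagU q ≤ b + 1) ∧
      (c - 1 ≤ diagV q ∧ diagV q ≤ d + 1) ∧
      (diagV q = c - 1 ∨ diagU q = b + 1 ∨ diagV q = d + 1 ∨ diagU q = a - 1) := by
    intro q hq
    rw [Finset.mem_sdiff, mem_latticeNeighbors, mem_of_coe_eq_boxRegion hB] at hq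
    obtain ⟨⟨p, hp, hqp⟩, hq⟩ := hq
    rw [mem_of_coe_eq_boxRegion hB] at hp
    rw [latticeGraph_adj_iff] at hqp
    omega
  have card_le : (latticeNeighbors B \ B).card ≤
      (Finset.Ico (0 : ℤ) ((b - a) + (d - c) + 4)).card := by
    refine Finset.card_le_card_of_injOn (fun q => t q / 2) (fun q hq => ?_) fun p hp q hq h => ?_
    · have := on_frame q hq
      simp only [t, Finset.coe_Ico, Set.mem_Ico]
      split_ifs <;> omega
    · obtain ⟨p1, p2, p3⟩ := on_frame p hp
      obtain ⟨q1, q2, q3⟩ := on_frame q hq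
      have p_parity := two_dvd_diagV_sub_diagU p
      have q_parity := two_dvd_diagV_sub_diagU q
      simp only [t] at h
      clear_value t
      clear on_frame hp hq
      refine diag_ext ?_ ?_ <;> split_ifs at h <;> omega
  rw [boundarySize_eq_card_sdiff]
  rw [Int.card_Ico] at card_le
  omega

theorem image_diagU_box {B : Finset (ℤ × ℤ)} {a b c d : ℤ}
    (hB : (B : Set (ℤ × ℤ)) = boxRegion a b c d) (hcd : c < d) :
    B.image diagU = Finset.Icc a b := by
  ext w
  simp only [Finset.mem_image, Finset.mem_Icc, mem_of_coe_eq_boxRegion hB]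
  refine ⟨by rintro ⟨p, hp, rfl⟩; exact hp.1, fun hw => ⟨ofDiag w (c + (w - c) % 2), ?_⟩⟩
  rw [diagU_ofDiag (by omega), diagV_ofDiag (by omega)]
  omega

theorem image_diagV_box {B : Finset (ℤ × ℤ)} {a b c d : ℤ}
    (hB : (B : Set (ℤ × ℤ)) = boxRegion a b c d) (hab : a < b) :
    B.image diagV = Finset.Icc c d := by
  ext w
  simp only [Finset.mem_image, Finset.mem_Icc, mem_of_coe_eq_boxRegion hB]
  refine ⟨by rintro ⟨p, hp, rfl⟩; exact hp.2, fun hw => ⟨ofDiag (a + (w - a) % 2) w, ?_⟩⟩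
  rw [diagU_ofDiag (by omega), diagV_ofDiag (by omega)]
  omega

theorem IsBox.boundarySize_eq {B : Finset (ℤ × ℤ)} (hB : IsBox B) {p : ℤ × ℤ} (hp : p ∈ B)
    (hU : 1 < (B.filter fun q => diagU q = diagU p).card)
    (hV : 1 < (B.filter fun q => diagV q = diagV p).card) :
    boundarySize B = (B.image diagU).card + (B.image diagV).card + 2 := by
  refine le_antisymm ?_ (card_image_add_card_image_add_two_le_boundarySize hB.1)
  obtain ⟨-, a, b, c, d, hB⟩ := hB
  obtain ⟨q, hq, hqp⟩ := Finset.exists_mem_ne hU p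
  obtain ⟨r, hr, hrp⟩ := Finset.exists_mem_ne hV p
  rw [Finset.mem_filter, mem_of_coe_eq_boxRegion hB] at hq hr
  rw [mem_of_coe_eq_boxRegion hB] at hp
  have hab : a < b := by
    have : diagU r ≠ diagU p := fun h => hrp (diag_ext h hr.2)
    omega
  have hcd : c < d := by
    have : diagV q ≠ diagV p := fun h => hqp (diag_ext hq.2 h)
    omega
  have := boundarySize_box_le hB hab.le hcd.le
  rw [image_diagU_box hB hcd, image_diagV_box hB hab, Int.card_Icc, Int.card_Icc]
  omega

theorem IsBox.subset_of_boundarySize_le {A B : Finset (ℤ × ℤ)} (hB : IsBox B)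
    (hB' : boundarySize B = (B.image diagU).card + (B.image diagV).card + 2)
    (hU : B.image diagU ⊆ A.image diagU) (hV : B.image diagV ⊆ A.image diagV)
    (hAB : boundarySize A ≤ boundarySize B) : A ⊆ B := by
  have hA : A.Nonempty := (hB.1.image diagU |>.mono hU).of_image
  have := card_image_add_card_image_add_two_le_boundarySize hA
  have := Finset.card_le_card hU
  have := Finset.card_le_card hV
  have image_U : B.image diagU = A.image diagU := Finset.eq_of_subset_of_card_le hU (by omega)
  have image_V : B.image diagV = A.image diagV := Finset.eq_of_subset_of_card_le hV (by omega)
  intro p hp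
  rw [hB.mem_iff, image_U, image_V]
  exact ⟨Finset.mem_image_of_mem _ hp, Finset.mem_image_of_mem _ hp⟩

theorem image_subset_image_of_card_sdiff_lt {α β : Type*} [DecidableEq α] [DecidableEq β]
    {A B : Finset α} {f : α → β}
    (h : ∀ p ∈ B, (B \ A).card < (B.filter fun q => f q = f p).card) :
    B.image f ⊆ A.image f := by
  intro w hw
  obtain ⟨p, hp, rfl⟩ := Finset.mem_image.1 hw
  obtain ⟨q, hq, hqA⟩ := Finset.exists_mem_notMem_of_card_lt_card (h p hp)
  rw [Finset.mem_filter] at hq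
  have : q ∈ A := by simpa [hq.1] using hqA
  exact Finset.mem_image.2 ⟨q, this, hq.2⟩

theorem le_card_filter_diagU_box {B : Finset (ℤ × ℤ)} {a b c d : ℤ} {n : ℕ}
    (hB : (B : Set (ℤ × ℤ)) = boxRegion a b c d) (hn : 2 * (n : ℤ) ≤ d - c + 1) {p : ℤ × ℤ}
    (hp : p ∈ B) : n ≤ (B.filter fun q => diagU q = diagU p).card := by
  rw [mem_of_coe_eq_boxRegion hB] at hp
  refine Finset.le_card_of_inj_on_range
    (fun i => ofDiag (diagU p) (c + (diagU p - c) % 2 + 2 * i)) (fun i hi => ?_)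
    fun i _ j _ h => ?_
  · rw [Finset.mem_filter, mem_of_coe_eq_boxRegion hB, diagU_ofDiag (by omega),
      diagV_ofDiag (by omega)]
    omega
  · have := congrArg diagV h
    rw [diagV_ofDiag (by omega), diagV_ofDiag (by omega)] at this
    omega

theorem le_card_filter_diagV_box {B : Finset (ℤ × ℤ)} {a b c d : ℤ} {n : ℕ}
    (hB : (B : Set (ℤ × ℤ)) = boxRegion a b c d) (hn : 2 * (n : ℤ) ≤ b - a + 1) {p : ℤ × ℤ}
    (hp : p ∈ B) : n ≤ (B.filter fun q => diagV q = diagV p).card := by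
  rw [mem_of_coe_eq_boxRegion hB] at hp
  refine Finset.le_card_of_inj_on_range
    (fun i => ofDiag (a + (diagV p - a) % 2 + 2 * i) (diagV p)) (fun i hi => ?_)
    fun i _ j _ h => ?_
  · rw [Finset.mem_filter, mem_of_coe_eq_boxRegion hB, diagU_ofDiag (by omega),
      diagV_ofDiag (by omega)]
    omega
  · have := congrArg diagU h
    rw [diagU_ofDiag (by omega), diagU_ofDiag (by omega)] at this
    omega

end Boxes

section Chains

variable {α : Type*}

theorem chainHeight_ssubset_le_card {S : Set (Finset α)} {T : Finset ℕ}
    (hS : ∀ A ∈ S, A.card ∈ T) : S.chainHeight (· ⊂ ·) ≤ T.card := by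
  refine iSup_le ?_
  rintro ⟨t, htS, ht⟩
  have card_injOn : Set.InjOn Finset.card t := by
    intro A hA A' hA' hcard
    by_contra hne
    rcases ht hA hA' hne with h | h
    · exact (Finset.card_lt_card h).ne hcard
    · exact (Finset.card_lt_card h).ne' hcard
  rw [← Set.encard_coe_eq_coe_finsetCard]
  exact Set.encard_le_encard_of_injOn (fun A hA => hS A (htS hA)) card_injOn

theorem card_le_chainHeight_ssubset {S : Set (Finset α)} {T : Finset ℕ} {s : ℕ → Finset α}
    (hs : Monotone s) (hcard : ∀ k ∈ T, (s k).card = k) (hS : ∀ k ∈ T, s k ∈ S) :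
    (T.card : ℕ∞) ≤ S.chainHeight (· ⊂ ·) := by
  have s_injOn : Set.InjOn s T := by
    intro k hk l hl hkl
    rw [← hcard k hk, hkl, hcard l hl]
  rw [← Set.encard_coe_eq_coe_finsetCard, ← s_injOn.encard_image]
  refine Set.encard_le_chainHeight_of_isChain _ _ (Set.image_subset_iff.2 hS) ?_
  rintro _ ⟨k, -, rfl⟩ _ ⟨l, -, rfl⟩ hne
  rcases le_total k l with hkl | hlk
  · exact Or.inl ((hs hkl).lt_of_ne hne)
  · exact Or.inr ((hs hlk).lt_of_ne hne.symm)

theorem subset_or_subset_of_card_symmDiff_eq_one [DecidableEq α] {A A' : Finset α}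
    (h : (A ∆ A').card = 1) :
    (A ⊆ A' ∧ A'.card = A.card + 1) ∨ (A' ⊆ A ∧ A.card = A'.card + 1) := by
  have card_symmDiff : (A ∆ A').card = (A \ A').card + (A' \ A).card :=
    Finset.card_union_of_disjoint disjoint_sdiff_sdiff
  have := Finset.card_sdiff_add_card A A'
  have := Finset.card_sdiff_add_card A' A
  rw [Finset.union_comm A' A] at this
  rcases Nat.eq_zero_or_pos (A \ A').card with h₀ | h₀
  · exact Or.inl ⟨Finset.sdiff_eq_empty_iff_subset.1 (Finset.card_eq_zero.1 h₀), by omega⟩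
  · have h₁ : (A' \ A).card = 0 := by omega
    exact Or.inr ⟨Finset.sdiff_eq_empty_iff_subset.1 (Finset.card_eq_zero.1 h₁), by omega⟩

end Chains

section Component

theorem isDead_iff {A : Finset (ℤ × ℤ)} : IsDead A ↔ IsMinimal A ∧
    ∀ A' : Finset (ℤ × ℤ), A ⊆ A' → A'.card = A.card + 1 → ¬ IsMinimal A' := by
  refine and_congr_right fun hA => ⟨fun h A' hAA' hcard hA' => ?_, fun h => ?_⟩
  · have one_le : ((1 : ℕ) : ℕ∞) ≤ lifeExpectancy A := by
      refine le_iSup₂_of_le 1 ⟨![A, A'], rfl, ?_, ?_⟩ le_rfl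
      · rw [Fin.monotone_iff_le_succ]
        intro i
        fin_cases i
        exact hAA'
      · intro i
        fin_cases i
        · exact ⟨hA, rfl⟩
        · exact ⟨hA', hcard⟩
    simp [h] at one_le
  · refine le_antisymm (iSup₂_le ?_) bot_le
    rintro (_ | n) ⟨s, h₀, hmono, hs⟩
    · simp
    · refine absurd (hs 1).1 (h _ ?_ ?_)
      · rw [← h₀]
        exact hmono (Fin.zero_le 1)
      · simpa using (hs 1).2

/-- A dead box of excess `d` all of whose nonempty intersections with standard lines have at least
`d + 2` points, written as fibres of the diagonal coordinates. -/
structure IsDeadBoxWithLongLines (B : Finset (ℤ × ℤ)) (d : ℕ) : Prop where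
  isBox : IsBox B
  isDead : IsDead B
  excess_eq : excess B = d
  le_card_lineU : ∀ p ∈ B, d + 2 ≤ (B.filter fun q => diagU q = diagU p).card
  le_card_lineV : ∀ p ∈ B, d + 2 ≤ (B.filter fun q => diagV q = diagV p).card

theorem le_card_filter_of_inter_eq_empty_or_le_ncard {α β : Type*} [DecidableEq β] {B : Finset α}
    {n : ℕ} {f : α → β} {p : α} (hp : p ∈ B)
    (h : (B : Set α) ∩ {q | f q = f p} = ∅ ∨ n ≤ ((B : Set α) ∩ {q | f q = f p}).ncard) :
    n ≤ (B.filter fun q => f q = f p).card := by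
  rw [← Set.ncard_coe_finset, Finset.coe_filter]
  exact h.resolve_left (Set.Nonempty.ne_empty ⟨p, hp, rfl⟩)

theorem isDeadBoxWithLongLines_of_isStandardLine {B : Finset (ℤ × ℤ)} {d : ℕ} (hB : IsBox B)
    (hdead : IsDead B) (hexc : excess B = d)
    (hlines : ∀ L : Set (ℤ × ℤ), IsStandardLine L →
      (B : Set (ℤ × ℤ)) ∩ L = ∅ ∨ d + 2 ≤ ((B : Set (ℤ × ℤ)) ∩ L).ncard) :
    IsDeadBoxWithLongLines B d where
  isBox := hB
  isDead := hdead
  excess_eq := hexc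
  le_card_lineU p hp :=
    le_card_filter_of_inter_eq_empty_or_le_ncard hp (hlines _ ⟨diagU p, Or.inl rfl⟩)
  le_card_lineV p hp :=
    le_card_filter_of_inter_eq_empty_or_le_ncard hp (hlines _ ⟨diagV p, Or.inr rfl⟩)

/-- The class has a representative inside `B` that misses at most `d` points of `B`. -/
def RepresentedWithin (B : Finset (ℤ × ℤ)) (d : ℕ) (v : MinimalClass) : Prop :=
  ∃ A, Represents A v ∧ A ⊆ B ∧ B.card ≤ A.card + d

namespace IsDeadBoxWithLongLines

variable {A A' B : Finset (ℤ × ℤ)} {d : ℕ} {v w : MinimalClass}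
  {C : minimalSetGraph.ConnectedComponent}

theorem boundarySize_eq (h : IsDeadBoxWithLongLines B d) :
    boundarySize B = (B.image diagU).card + (B.image diagV).card + 2 := by
  obtain ⟨p, hp⟩ := h.isBox.1
  exact h.isBox.boundarySize_eq hp (lt_of_lt_of_le (by omega) (h.le_card_lineU p hp))
    (lt_of_lt_of_le (by omega) (h.le_card_lineV p hp))

theorem exists_isMinimal (h : IsDeadBoxWithLongLines B d) : ∃ B₀ : Finset (ℤ × ℤ),
    IsMinimal B₀ ∧ boundarySize B₀ = boundarySize B ∧ B.card = B₀.card + d := by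
  obtain ⟨B₀, hB₀, hbd, hcard⟩ := h.isDead.1.excess_isGreatest.1
  rw [h.excess_eq] at hcard
  exact ⟨B₀, hB₀, hbd.symm, by omega⟩

theorem lt_card (h : IsDeadBoxWithLongLines B d) : d < B.card := by
  obtain ⟨B₀, hB₀, -, hcard⟩ := h.exists_isMinimal
  have := hB₀.1.card_pos
  omega

theorem isMinimal_of_boundarySize_le (h : IsDeadBoxWithLongLines B d)
    (hcard : B.card ≤ A.card + d) (hbd : boundarySize A ≤ boundarySize B) : IsMinimal A := by
  obtain ⟨B₀, hB₀, hbd₀, hcard₀⟩ := h.exists_isMinimal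
  have := h.lt_card
  refine ⟨Finset.card_pos.1 (by omega), fun A' hA' => ?_⟩
  rw [← hbd₀] at hbd
  exact hbd.trans (hB₀.boundarySize_le (by omega))

theorem card_le_of_boundarySize_eq (h : IsDeadBoxWithLongLines B d) (hA : IsMinimal A)
    (hbd : boundarySize A = boundarySize B) : B.card ≤ A.card + d := by
  have := h.isDead.1.excess_isGreatest.2 ⟨A, hA, hbd.symm, rfl⟩
  rw [h.excess_eq] at this
  omega

theorem image_subset_image (h : IsDeadBoxWithLongLines B d) (hAB : A ⊆ B)
    (hcard : B.card ≤ A.card + (d + 1)) :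
    B.image diagU ⊆ A.image diagU ∧ B.image diagV ⊆ A.image diagV := by
  have := Finset.card_sdiff_add_card_eq_card hAB
  constructor <;> refine image_subset_image_of_card_sdiff_lt fun p hp => ?_
  · have := h.le_card_lineU p hp
    omega
  · have := h.le_card_lineV p hp
    omega

theorem subset_of_isMinimal_succ (h : IsDeadBoxWithLongLines B d) (hAB : A ⊆ B)
    (hcard : B.card ≤ A.card + d) (hAA' : A ⊆ A') (hcard' : A'.card = A.card + 1)
    (hA' : IsMinimal A') : A' ⊆ B := by
  rcases hAB.eq_or_ssubset with rfl | hlt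
  · exact absurd hA' ((isDead_iff.1 h.isDead).2 A' hAA' hcard')
  · have := Finset.card_lt_card hlt
    obtain ⟨hU, hV⟩ := h.image_subset_image hAB (by omega)
    exact h.isBox.subset_of_boundarySize_le h.boundarySize_eq
      (hU.trans (Finset.image_subset_image hAA')) (hV.trans (Finset.image_subset_image hAA'))
      (hA'.boundarySize_le (by omega))

theorem card_le_of_isMinimal (h : IsDeadBoxWithLongLines B d) (hAB : A ⊆ B)
    (hcard : B.card ≤ A.card + (d + 1)) (hA : IsMinimal A) : B.card ≤ A.card + d := by
  obtain ⟨hU, hV⟩ := h.image_subset_image hAB hcard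
  refine h.card_le_of_boundarySize_eq hA
    (le_antisymm (hA.boundarySize_le (Finset.card_le_card hAB)) ?_)
  calc boundarySize B = (B.image diagU).card + (B.image diagV).card + 2 := h.boundarySize_eq
    _ ≤ (A.image diagU).card + (A.image diagV).card + 2 :=
      Nat.add_le_add_right (Nat.add_le_add (Finset.card_le_card hU) (Finset.card_le_card hV)) 2
    _ ≤ boundarySize A := card_image_add_card_image_add_two_le_boundarySize hA.1

theorem representedWithin_of_adj (h : IsDeadBoxWithLongLines B d)
    (hv : RepresentedWithin B d v) (hvw : minimalSetGraph.Adj v w) :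
    RepresentedWithin B d w := by
  obtain ⟨A, hA, hAB, hcard⟩ := hv
  obtain ⟨A', hA', hAA'⟩ := hA.exists_of_adj hvw
  rcases subset_or_subset_of_card_symmDiff_eq_one hAA' with ⟨hsub, hcard'⟩ | ⟨hsub, hcard'⟩
  · exact ⟨A', hA', h.subset_of_isMinimal_succ hAB hcard hsub hcard' hA'.1, by omega⟩
  · exact ⟨A', hA', hsub.trans hAB,
      h.card_le_of_isMinimal (hsub.trans hAB) (by omega) hA'.1⟩

theorem representedWithin_of_mem_supp (h : IsDeadBoxWithLongLines B d)
    (hC : B ∈ setsInComponent C) (hv : v ∈ C.supp) : RepresentedWithin B d v := by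
  obtain ⟨u, hu, hBu⟩ := hC
  have hu' : RepresentedWithin B d u := ⟨B, hBu, subset_rfl, by omega⟩
  obtain ⟨p⟩ := SimpleGraph.ConnectedComponent.exact (hu.trans hv.symm)
  clear hu hv hBu
  induction p with
  | nil => exact hu'
  | cons hadj _ ih => exact ih (h.representedWithin_of_adj hu' hadj)

theorem of_mem_setsInComponent (h : IsDeadBoxWithLongLines B d) (hC : B ∈ setsInComponent C)
    (hA : A ∈ setsInComponent C) : B.card ≤ A.card + d ∧ A.card ≤ B.card ∧
      ∃ E : Finset (ℤ × ℤ), IsEnclosingBox A E ∧ LatticeCongruent E B := by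
  obtain ⟨v, hv, hAv⟩ := hA
  obtain ⟨A₀, hA₀, hAB, hcard⟩ := h.representedWithin_of_mem_supp hC hv
  obtain ⟨φ, rfl⟩ := hA₀.exists_image_eq hAv
  rw [Finset.card_image_of_injective _ φ.injective]
  obtain ⟨hU, hV⟩ := h.image_subset_image hAB (by omega)
  exact ⟨hcard, Finset.card_le_card hAB, B.image φ,
    (isEnclosingBox_of_image_subset h.isBox hAB hU hV).image φ,
    latticeCongruent_iff.2 ⟨φ.symm, image_symm_image φ B⟩⟩

theorem finite_supp (h : IsDeadBoxWithLongLines B d) (hC : B ∈ setsInComponent C) :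
    C.supp.Finite := by
  choose! rep represents rep_subset _ using
    fun (v : MinimalClass) (hv : v ∈ C.supp) => h.representedWithin_of_mem_supp hC hv
  refine Set.Finite.of_finite_image (f := rep) (B.powerset.finite_toSet.subset ?_) ?_
  · rintro _ ⟨v, hv, rfl⟩
    exact Finset.mem_coe.2 (Finset.mem_powerset.2 (rep_subset v hv))
  · intro v hv w hw hvw
    obtain ⟨_, hv'⟩ := represents v hv
    obtain ⟨_, hw'⟩ := represents w hw
    rw [← hv', ← hw']
    congr 1

theorem exists_monotone_mem_setsInComponent (h : IsDeadBoxWithLongLines B d)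
    (hC : B ∈ setsInComponent C) : ∃ s : ℕ → Finset (ℤ × ℤ), Monotone s ∧
      ∀ k ∈ Finset.Icc (B.card - d) B.card, (s k).card = k ∧ s k ∈ setsInComponent C := by
  obtain ⟨s, hs, hsB, hs'⟩ := exists_monotone_boundarySize_le B
  refine ⟨s, hs, fun k hk => ⟨(hs' k (Finset.mem_Icc.1 hk).2).1, ?_⟩⟩
  rw [Finset.mem_Icc] at hk
  obtain ⟨hdk, hkB⟩ := hk
  induction hkB using Nat.decreasingInduction with
  | self => rwa [hsB]
  | of_succ k hkB ih =>
    obtain ⟨v, hv, hrep⟩ := ih (by omega)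
    obtain ⟨hcard, hbd⟩ := hs' k hkB.le
    have hmin : IsMinimal (s k) := h.isMinimal_of_boundarySize_le (by omega) hbd
    have hadj : minimalSetGraph.Adj (minimalClass _ hmin) v := by
      refine ⟨_, _, represents_minimalClass hmin, hrep, ?_⟩
      rw [symmDiff_of_le (hs k.le_succ), Finset.card_sdiff_of_subset (hs k.le_succ), hcard,
        (hs' (k + 1) hkB).1]
      omega
    exact ⟨minimalClass _ hmin, (SimpleGraph.ConnectedComponent.sound hadj.reachable).trans hv,
      represents_minimalClass hmin⟩

theorem componentHeight_eq (h : IsDeadBoxWithLongLines B d) (hC : B ∈ setsInComponent C) :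
    componentHeight C = (d : ℕ∞) + 1 := by
  have card_sizes : ((Finset.Icc (B.card - d) B.card).card : ℕ∞) = d + 1 := by
    have := h.lt_card
    rw [Nat.card_Icc, show B.card + 1 - (B.card - d) = d + 1 by omega]
    norm_cast
  rw [← card_sizes]
  obtain ⟨s, hs, hs'⟩ := h.exists_monotone_mem_setsInComponent hC
  refine le_antisymm (chainHeight_ssubset_le_card fun A hA => ?_)
    (card_le_chainHeight_ssubset hs (fun k hk => (hs' k hk).1) fun k hk => (hs' k hk).2)
  have := h.of_mem_setsInComponent hC hA
  rw [Finset.mem_Icc]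
  omega

theorem isIsolated (h : IsDeadBoxWithLongLines B 0) :
    minimalSetGraph.IsIsolated (minimalClass B h.isDead.1) := by
  intro w hw
  have hB := represents_minimalClass h.isDead.1
  obtain ⟨A, hA, hAB, hcard⟩ := h.representedWithin_of_adj ⟨B, hB, subset_rfl, le_rfl⟩ hw
  obtain rfl := Finset.eq_of_subset_of_card_le hAB hcard
  obtain ⟨_, hw'⟩ := hA
  exact hw.ne hw'

end IsDeadBoxWithLongLines

end Component

section Examples

theorem cast_two_mul_choose_two (s : ℕ) : 2 * (s.choose 2 : ℤ) = s * (s - 1) := by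
  have := Nat.cast_choose_two ℚ s
  have : 2 * (s.choose 2 : ℚ) = s * (s - 1) := by rw [this]; ring
  exact_mod_cast this

/-- The box with `0 ≤ y - x < 2 * m` and `0 ≤ y + x < k`, which has exactly `m * k` points because
one of its diagonal extents is even. It provides all examples. -/
def evenBox (m k : ℕ) : Finset (ℤ × ℤ) :=
  (Finset.range m ×ˢ Finset.range k).image fun i : ℕ × ℕ => ofDiag (2 * i.1 + i.2 % 2) i.2

theorem coe_evenBox (m k : ℕ) :
    (evenBox m k : Set (ℤ × ℤ)) = boxRegion 0 (2 * m - 1) 0 ((k : ℤ) - 1) := by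
  ext p
  simp only [evenBox, Finset.mem_coe, Finset.mem_image, Finset.mem_product, Finset.mem_range,
    Prod.exists, mem_boxRegion]
  constructor
  · rintro ⟨i, j, ⟨hi, hj⟩, rfl⟩
    rw [diagU_ofDiag (by omega), diagV_ofDiag (by omega)]
    omega
  · intro h
    have := two_dvd_diagV_sub_diagU p
    refine ⟨(diagU p / 2).toNat, (diagV p).toNat, by omega, diag_ext ?_ ?_⟩
    · rw [diagU_ofDiag (by omega)]
      omega
    · rw [diagV_ofDiag (by omega)]
      omega

theorem card_evenBox (m k : ℕ) : (evenBox m k).card = m * k := by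
  rw [evenBox, Finset.card_image_of_injective, Finset.card_product, Finset.card_range,
    Finset.card_range]
  rintro ⟨i, j⟩ ⟨i', j'⟩ h
  have hU := congrArg diagU h
  have hV := congrArg diagV h
  simp (disch := omega) only [diagU_ofDiag, diagV_ofDiag] at hU hV
  simp only [Prod.mk.injEq]
  omega

theorem boundarySize_evenBox_le {m k : ℕ} (hm : 0 < m) (hk : 0 < k) :
    boundarySize (evenBox m k) ≤ 2 * m + k + 2 := by
  have := boundarySize_box_le (coe_evenBox m k) (by omega) (by omega)
  omega

theorem le_boundarySize_of_choose_two_lt_card {A : Finset (ℤ × ℤ)} {s : ℕ}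
    (h : s.choose 2 < A.card) : 2 * s + 2 ≤ boundarySize A := by
  have := card_image_add_card_image_add_two_le_boundarySize (A := A) (Finset.card_pos.1 (by omega))
  by_contra! hlt
  have sq_le : ((boundarySize A : ℤ) - 2) ^ 2 ≤ (2 * s - 1) ^ 2 :=
    pow_le_pow_left₀ (by omega) (by omega) 2
  have := eight_mul_card_le_sq A
  have := cast_two_mul_choose_two s
  have : 8 * (A.card : ℤ) ≤ 8 * (s.choose 2 : ℤ) + 5 := by linarith
  omega

theorem exists_card_eq_choose_two {s : ℕ} (hs : 2 ≤ s) :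
    ∃ A : Finset (ℤ × ℤ), A.card = s.choose 2 ∧ boundarySize A ≤ 2 * s + 1 := by
  have hchoose := cast_two_mul_choose_two s
  obtain ⟨r, rfl | rfl⟩ := s.even_or_odd'
  · refine ⟨evenBox r (2 * r - 1), ?_, ?_⟩
    · rw [card_evenBox]
      zify [show 1 ≤ 2 * r by omega]
      push_cast at hchoose
      linarith
    · have := boundarySize_evenBox_le (m := r) (k := 2 * r - 1) (by omega) (by omega)
      omega
  · refine ⟨evenBox r (2 * r + 1), ?_, ?_⟩
    · rw [card_evenBox]
      push_cast at hchoose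
      zify
      linarith
    · have := boundarySize_evenBox_le (m := r) (k := 2 * r + 1) (by omega) (by omega)
      omega

theorem isMinimal_of_choose_two_lt_card {A : Finset (ℤ × ℤ)} {s : ℕ} (hA : s.choose 2 < A.card)
    (hbd : boundarySize A ≤ 2 * s + 2) : IsMinimal A :=
  ⟨Finset.card_pos.1 (by omega),
    fun _ hA' => hbd.trans (le_boundarySize_of_choose_two_lt_card (by omega))⟩

theorem excess_eq_of_choose_two_lt_card {B : Finset (ℤ × ℤ)} {s : ℕ} (hs : 2 ≤ s)
    (hB : s.choose 2 < B.card) (hbd : boundarySize B ≤ 2 * s + 2) :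
    excess B = B.card - (s.choose 2 + 1) := by
  have hBle := le_boundarySize_of_choose_two_lt_card hB
  refine (isMinimal_of_choose_two_lt_card hB hbd).excess_isGreatest.unique ⟨?_, ?_⟩
  · obtain ⟨A, -, -, hA⟩ := exists_monotone_boundarySize_le B
    obtain ⟨hcard, hle⟩ := hA (s.choose 2 + 1) hB
    have hAle := le_boundarySize_of_choose_two_lt_card (A := A (s.choose 2 + 1)) (s := s)
      (by omega)
    exact ⟨_, isMinimal_of_choose_two_lt_card (by omega) (hle.trans hbd), by omega, by omega⟩
  · rintro _ ⟨A, hA, hAB, rfl⟩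
    obtain ⟨D, hD, hDbd⟩ := exists_card_eq_choose_two hs
    have hAcard : s.choose 2 < A.card := by
      by_contra hle
      have := hA.boundarySize_le (B := D) (by omega)
      omega
    omega

theorem IsBox.isDead_of_card_lt {B D : Finset (ℤ × ℤ)} (hB : IsBox B)
    (hB' : boundarySize B = (B.image diagU).card + (B.image diagV).card + 2) (hmin : IsMinimal B)
    (hcard : B.card < D.card) (hbd : boundarySize D ≤ boundarySize B) : IsDead B := by
  refine isDead_iff.2 ⟨hmin, fun A hBA hA hAmin => ?_⟩
  have hAB : A ⊆ B := hB.subset_of_boundarySize_le hB' (Finset.image_subset_image hBA)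
    (Finset.image_subset_image hBA) ((hAmin.boundarySize_le (by omega)).trans hbd)
  have := Finset.card_le_card hAB
  omega

/-- A family of boxes that are dead of excess `d` for `t ≥ 2`. With `s = 2 * a + t`, a box with
`2 * a` and `2 * (a + t)` diagonals has boundary size `2 * s + 2` and exceeds the size
`s.choose 2 + 1` of the smallest minimal set with that boundary size by `a - t.choose 2 - 1`. -/
def deadBox (d t : ℕ) : Finset (ℤ × ℤ) :=
  evenBox (d + 1 + t.choose 2) (2 * (d + 1 + t.choose 2 + t))

theorem card_deadBox (d t : ℕ) :
    (deadBox d t).card = (2 * (d + 1 + t.choose 2) + t).choose 2 + 1 + d := by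
  have hs := cast_two_mul_choose_two (2 * (d + 1 + t.choose 2) + t)
  have := cast_two_mul_choose_two t
  push_cast at hs
  rw [deadBox, card_evenBox]
  zify
  linarith

theorem isDeadBoxWithLongLines_deadBox (d : ℕ) {t : ℕ} (ht : 2 ≤ t) :
    IsDeadBoxWithLongLines (deadBox d t) d := by
  have hcard := card_deadBox d t
  have one_le_choose : 1 ≤ t.choose 2 := Nat.choose_pos ht
  rw [deadBox] at hcard ⊢
  obtain ⟨a, ha⟩ : ∃ a, a = d + 1 + t.choose 2 := ⟨_, rfl⟩
  rw [← ha] at hcard ⊢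
  have hreg := coe_evenBox a (2 * (a + t))
  have hle : boundarySize (evenBox a (2 * (a + t))) ≤ 2 * (2 * a + t) + 2 :=
    (boundarySize_evenBox_le (by omega) (by omega)).trans (by omega)
  have hge : 2 * (2 * a + t) + 2 ≤ boundarySize (evenBox a (2 * (a + t))) :=
    le_boundarySize_of_choose_two_lt_card (by omega)
  have hmin := isMinimal_of_choose_two_lt_card (by omega) hle
  have hbox : IsBox (evenBox a (2 * (a + t))) := ⟨hmin.1, _, _, _, _, hreg⟩
  have lineU : ∀ p ∈ evenBox a (2 * (a + t)),
      d + 2 ≤ ((evenBox a (2 * (a + t))).filter fun q => diagU q = diagU p).card :=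
    fun p hp => le_card_filter_diagU_box hreg (by push_cast; omega) hp
  have lineV : ∀ p ∈ evenBox a (2 * (a + t)),
      d + 2 ≤ ((evenBox a (2 * (a + t))).filter fun q => diagV q = diagV p).card :=
    fun p hp => le_card_filter_diagV_box hreg (by omega) hp
  obtain ⟨p, hp⟩ := hmin.1
  have hB := hbox.boundarySize_eq hp (lt_of_lt_of_le (by omega) (lineU p hp))
    (lt_of_lt_of_le (by omega) (lineV p hp))
  have card_lt : (evenBox a (2 * (a + t))).card < (evenBox (a + 1) (2 * (a + t - 1))).card := by
    obtain ⟨c, rfl⟩ := Nat.exists_eq_add_of_le' ht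
    rw [card_evenBox, card_evenBox, show a + (c + 2) - 1 = a + c + 1 by omega]
    nlinarith
  have squarer_le : boundarySize (evenBox (a + 1) (2 * (a + t - 1))) ≤ 2 * (2 * a + t) + 2 :=
    (boundarySize_evenBox_le (by omega) (by omega)).trans (by omega)
  refine ⟨hbox, hbox.isDead_of_card_lt hB hmin card_lt (squarer_le.trans hge), ?_, lineU, lineV⟩
  rw [excess_eq_of_choose_two_lt_card (by omega) (by omega) hle]
  omega

theorem strictMono_card_deadBox (d : ℕ) : StrictMono fun t => (deadBox d t).card := by
  intro t t' h
  have := Nat.choose_le_choose 2 h.le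
  simp only [deadBox, card_evenBox]
  exact Nat.mul_lt_mul_of_le_of_lt (by omega) (by omega) (by omega)

end Examples

theorem mem_setsInComponent_connectedComponentMk {A : Finset (ℤ × ℤ)} (hA : IsMinimal A) :
    A ∈ setsInComponent (minimalSetGraph.connectedComponentMk (minimalClass A hA)) :=
  ⟨_, rfl, represents_minimalClass hA⟩

theorem mainTheorem9 :
    -- the criterion for finite components
    (∀ (B : Finset (ℤ × ℤ)) (d : ℕ) (α β : ℤ), IsBox B →
      excess B = (d : ℤ) →
      HasModulus B s(α, β) → 2 ≤ α → 2 ≤ β →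
      (∀ L : Set (ℤ × ℤ), IsStandardLine L →
        (B : Set (ℤ × ℤ)) ∩ L = ∅ ∨ d + 2 ≤ ((B : Set (ℤ × ℤ)) ∩ L).ncard) →
      IsDead B →
      ∀ C : minimalSetGraph.ConnectedComponent, B ∈ setsInComponent C →
        (∀ A ∈ setsInComponent C,
          (B.card : ℤ) - (d : ℤ) ≤ (A.card : ℤ) ∧ A.card ≤ B.card ∧
          ∃ E : Finset (ℤ × ℤ), IsEnclosingBox A E ∧ LatticeCongruent E B) ∧
        (∀ k : ℕ, (B.card : ℤ) - (d : ℤ) ≤ (k : ℤ) → k ≤ B.card →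
          ∃ A ∈ setsInComponent C, A.card = k) ∧
        C.supp.Finite ∧
        componentHeight C = (d : ℕ∞) + 1) ∧
    -- finite components of arbitrarily large height
    (∀ n : ℕ, ∃ C : minimalSetGraph.ConnectedComponent, C.supp.Finite ∧
      ∃ h : ℕ, componentHeight C = (h : ℕ∞) ∧ n ≤ h) ∧
    -- infinitely many isolated vertices
    {v : MinimalClass | minimalSetGraph.IsIsolated v}.Infinite := by
  refine ⟨?_, fun n => ?_, ?_⟩
  · intro B d _ _ hB hexc _ _ _ hlines hdead C hC
    have h := isDeadBoxWithLongLines_of_isStandardLine hB hdead hexc hlines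
    refine ⟨fun A hA => ?_, fun k hk hkB => ?_, h.finite_supp hC, h.componentHeight_eq hC⟩
    · obtain ⟨hle, hAB⟩ := h.of_mem_setsInComponent hC hA
      exact ⟨by omega, hAB⟩
    · obtain ⟨s, -, hs⟩ := h.exists_monotone_mem_setsInComponent hC
      obtain ⟨hcard, hmem⟩ := hs k (Finset.mem_Icc.2 ⟨by omega, hkB⟩)
      exact ⟨s k, hmem, hcard⟩
  · have h := isDeadBoxWithLongLines_deadBox n le_rfl
    have hC := mem_setsInComponent_connectedComponentMk h.isDead.1
    exact ⟨_, h.finite_supp hC, n + 1, h.componentHeight_eq hC, n.le_succ⟩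
  · have h t := isDeadBoxWithLongLines_deadBox 0 (Nat.le_add_left 2 t)
    refine Set.infinite_of_injective_forall_mem (fun t t' htt' => ?_) fun t => (h t).isIsolated
    have hcard := LatticeCongruent.card_eq (Quotient.exact htt')
    exact Nat.add_right_cancel ((strictMono_card_deadBox 0).injective hcard)
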